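/- Let $d\ge 0$ be an integer, let $\mathcal P(\mathbf R^d)$ be the set of Borel probability measures on $\mathbf R^d$ and $\mathcal B(\mathbf R^d)$ the Borel $\sigma$-algebra. For a finite Borel measure $\mu$ put $\widehat\mu(\xi)=\int e^{-2\pi i\,\xi\cdot x}\,d\mu(x)$, and write $\widehat\mu(\xi)\lesssim|\xi|^{-s/2}$ if there is a constant $C$ with $|\widehat\mu(\xi)|\le C|\xi|^{-s/2}$ for all $\xi\in\mathbf R^d\setminus\{0\}$. Let $$\dim_{\mathrm F}\mu=\sup\{s\in[0,d];\ \widehat\mu(\xi)\lesssim|\xi|^{-s/2}\},\qquad \dim_{\mathrm{FM}}\mu=\sup\{\dim_{\mathrm F}\nu;\ \nu\in\mathcal P(\mathbf R^d),\ \mu\ll\nu\}.$$ For real $s$ let $$\mathcal C_s=\{\mu\in\mathcal P(\mathbf R^d);\ \exists\,\nu\in\mathcal P(\mathbf R^d)\text{ with }\mu\ll\nu\text{ and }\widehat\nu(\xi)\lesssim|\xi|^{-s/2}\},\qquad \mathcal M_s=\{\mu\in\mathcal P(\mathbf R^d);\ \dim_{\mathrm{FM}}\mu\ge s\}.$$ For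 $\mathcal C\subset\mathcal P(\mathbf R^d)$ and $\mathcal E\subset\mathcal B(\mathbf R^d)$ let $$\mathcal C^\perp=\{E\in\mathcal B(\mathbf R^d);\ \mu(E)=0\text{ for all }\mu\in\mathcal C\},\qquad \mathcal E^\perp=\{\mu\in\mathcal P(\mathbf R^d);\ \mu(E)=0\text{ for all }E\in\mathcal E\}.$$ Then $\mathcal C_s^{\perp\perp}=\mathcal C_s$ for all real $s\ge 0$, and $\mathcal M_s^{\perp\perp}=\mathcal M_s$ for all real $s$ with $0\le s\le d$. Equivalently to the latter, for $0\le s\le d$ a measure $\mu\in\mathcal P(\mathbf R^d)$ satisfies $\dim_{\mathrm{FM}}\mu\ge s$ if and only if $\mu(E)=0$ for every Borel set $E\subset\mathbf R^d$ such that $\nu(E)=0$ for all $\nu\in\mathcal P(\mathbf R^d)$ with $\dim_{\mathrm{FM}}\nu\ge s$. -/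

import Mathlib

open MeasureTheory Set

namespace FourierDim

/-- The space `ℝ^d` with its Euclidean norm and inner product. -/
abbrev Space (d : ℕ) : Type := EuclideanSpace ℝ (Fin d)

/-- The Fourier transform of a (finite) Borel measure,
`μ̂(ξ) = ∫ exp(-2πi ξ·x) dμ(x)`. -/
noncomputable def fourierTransform {d : ℕ} (μ : Measure (Space d)) (ξ : Space d) : ℂ :=
  ∫ x, Complex.exp (-2 * (Real.pi : ℂ) * Complex.I * ((inner ℝ ξ x : ℝ) : ℂ)) ∂μ

/-- `μ̂(ξ) ≲ |ξ|^{-s/2}`: there is one constant `C` with `|μ̂(ξ)| ≤ C |ξ|^{-s/2}` for all `ξ`.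
The point `ξ = 0` is left out: there `|ξ|^{-s/2}` is `+∞` for `s > 0` (but `0` for Lean's real
power), and for `s = 0` the bound is a bound by a constant, which holds at `0` anyway for a
finite measure after enlarging `C`. -/
def HasFourierDecay {d : ℕ} (μ : Measure (Space d)) (s : ℝ) : Prop :=
  ∃ C : ℝ, ∀ ξ : Space d, ξ ≠ 0 → ‖fourierTransform μ ξ‖ ≤ C * ‖ξ‖ ^ (-s / 2)

/-- The Fourier dimension of a finite Borel measure `μ` on `ℝ^d`:
`dim_F μ = sup {s ∈ [0, d] ; μ̂(ξ) ≲ |ξ|^{-s/2}}`. -/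
noncomputable def dimF {d : ℕ} (μ : Measure (Space d)) : ℝ :=
  sSup {s : ℝ | s ∈ Icc (0 : ℝ) (d : ℝ) ∧ HasFourierDecay μ s}

/-- The modified Fourier dimension of a finite Borel measure `μ` on `ℝ^d`:
`dim_FM μ = sup {dim_F ν ; ν a Borel probability measure with μ ≪ ν}`. -/
noncomputable def dimFM {d : ℕ} (μ : Measure (Space d)) : ℝ :=
  sSup {t : ℝ | ∃ ν : ProbabilityMeasure (Space d),
    μ ≪ (ν : Measure (Space d)) ∧ t = dimF (ν : Measure (Space d))}

/-- `𝒞_s`: the Borel probability measures that are absolutely continuous with respect to some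
Borel probability measure `ν` with `ν̂(ξ) ≲ |ξ|^{-s/2}`. -/
def classC (d : ℕ) (s : ℝ) : Set (ProbabilityMeasure (Space d)) :=
  {μ | ∃ ν : ProbabilityMeasure (Space d),
    (μ : Measure (Space d)) ≪ (ν : Measure (Space d)) ∧
      HasFourierDecay (ν : Measure (Space d)) s}

/-- `ℳ_s`: the Borel probability measures with modified Fourier dimension at least `s`. -/
def classM (d : ℕ) (s : ℝ) : Set (ProbabilityMeasure (Space d)) :=
  {μ | s ≤ dimFM (μ : Measure (Space d))}

/-- `𝒞^⊥` for a class `𝒞` of Borel probability measures: the Borel sets that are null for every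
measure in `𝒞`. -/
def nullSets {d : ℕ} (C : Set (ProbabilityMeasure (Space d))) : Set (Set (Space d)) :=
  {E | MeasurableSet E ∧ ∀ μ ∈ C, (μ : Measure (Space d)) E = 0}

/-- `ℰ^⊥` for a class `ℰ` of Borel sets: the Borel probability measures that vanish on every
set in `ℰ`. -/
def annihilators {d : ℕ} (S : Set (Set (Space d))) : Set (ProbabilityMeasure (Space d)) :=
  {μ | ∀ E ∈ S, (μ : Measure (Space d)) E = 0}

/-! The suprema that define `dimF` and `dimFM` are over nonempty bounded sets of reals. -/

theorem norm_fourierTransform_le {d : ℕ} (μ : Measure (Space d)) (ξ : Space d) :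
    ‖fourierTransform μ ξ‖ ≤ μ.real univ := by
  refine (norm_integral_le_integral_norm _).trans (le_of_eq ?_)
  have h : ∀ x : Space d,
      ‖Complex.exp (-2 * (Real.pi : ℂ) * Complex.I * ((inner ℝ ξ x : ℝ) : ℂ))‖ = 1 := by
    intro x
    rw [show (-2 * (Real.pi : ℂ) * Complex.I * ((inner ℝ ξ x : ℝ) : ℂ))
      = ((-2 * Real.pi * (inner ℝ ξ x : ℝ) : ℝ) : ℂ) * Complex.I by push_cast; ring]
    exact Complex.norm_exp_ofReal_mul_I _
  rw [integral_congr_ae (Filter.Eventually.of_forall h)]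
  simp

theorem hasFourierDecay_zero {d : ℕ} (μ : Measure (Space d)) : HasFourierDecay μ 0 :=
  ⟨μ.real univ, fun ξ _ => by simpa using norm_fourierTransform_le μ ξ⟩

theorem dimF_mem_Icc {d : ℕ} (μ : Measure (Space d)) :
    BddAbove {s : ℝ | s ∈ Icc (0 : ℝ) (d : ℝ) ∧ HasFourierDecay μ s} ∧
      dimF μ ∈ Icc (0 : ℝ) (d : ℝ) := by
  have hb : BddAbove {s : ℝ | s ∈ Icc (0 : ℝ) (d : ℝ) ∧ HasFourierDecay μ s} :=
    ⟨d, fun s hs => hs.1.2⟩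
  have h0 : (0 : ℝ) ∈ {s : ℝ | s ∈ Icc (0 : ℝ) (d : ℝ) ∧ HasFourierDecay μ s} :=
    ⟨⟨le_rfl, Nat.cast_nonneg d⟩, hasFourierDecay_zero μ⟩
  exact ⟨hb, le_csSup hb h0, csSup_le ⟨0, h0⟩ fun s hs => hs.1.2⟩

theorem dimFM_mem_Icc {d : ℕ} (μ : ProbabilityMeasure (Space d)) :
    BddAbove {t : ℝ | ∃ ν : ProbabilityMeasure (Space d),
      (μ : Measure (Space d)) ≪ (ν : Measure (Space d)) ∧ t = dimF (ν : Measure (Space d))} ∧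
      dimFM (μ : Measure (Space d)) ∈ Icc (0 : ℝ) (d : ℝ) := by
  have hb : BddAbove {t : ℝ | ∃ ν : ProbabilityMeasure (Space d),
      (μ : Measure (Space d)) ≪ (ν : Measure (Space d)) ∧
        t = dimF (ν : Measure (Space d))} := by
    refine ⟨d, ?_⟩
    rintro t ⟨ν, -, rfl⟩
    exact (dimF_mem_Icc _).2.2
  have h0 : dimF (μ : Measure (Space d)) ∈ {t : ℝ | ∃ ν : ProbabilityMeasure (Space d),
      (μ : Measure (Space d)) ≪ (ν : Measure (Space d)) ∧
        t = dimF (ν : Measure (Space d))} :=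
    ⟨μ, Measure.AbsolutelyContinuous.rfl, rfl⟩
  refine ⟨hb, (dimF_mem_Icc _).2.1.trans (le_csSup hb h0), csSup_le ⟨_, h0⟩ ?_⟩
  rintro t ⟨ν, -, rfl⟩
  exact (dimF_mem_Icc _).2.2

end FourierDim

/-! The inclusion of a class in its bidual is formal. For the converse for `classC`, an exhaustion
argument splits μ along a Borel set A into a part dominated by a measure with decay and a part
singular to every measure with decay (`exists_measurableSet_restrict_singular`). If μ annihilates
every common null set, the singular part must vanish.

For this one needs a single null set that carries the singular part. Measures with a fixed decay
constant and fixed tail bounds form a compact convex set, `decayClass`. Over such a set, Sion's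
minimax theorem turns singularity to each member into one Borel set that carries the singular part
and is null for all members (`exists_measurableSet_forall_null`). Multiplying by a Gaussian supplies
the tails without spoiling decay or enlarging the null sets, so countably many `decayClass`es
dominate all of `classC`. The intersection of their carriers is the required null set.

Finally `classM` at s is the intersection of the `classC` at t over 0 ≤ t < s (`mem_classM_iff`),
and being equal to one's bidual passes to intersections. -/

namespace FourierDim

open Filter Topology
open scoped BoundedContinuousFunction ENNReal NNReal

/-! ### Separating a measure from a compact convex set of measures -/

section Separation

variable {Ω : Type*} [MeasurableSpace Ω] [PseudoMetricSpace Ω] [BorelSpace Ω]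

theorem continuous_integral_bcf (μ : Measure Ω) [IsFiniteMeasure μ] :
    Continuous fun φ : Ω →ᵇ ℝ => ∫ x, φ x ∂μ := by
  refine (LipschitzWith.of_dist_le_mul (K := (μ univ).toNNReal) fun φ ψ => ?_).continuous
  rw [dist_eq_norm, dist_eq_norm, ← integral_sub (φ.integrable μ) (ψ.integrable μ)]
  exact (φ - ψ).norm_integral_le_mul_norm μ

/-- Two mutually singular finite measures are almost separated by a continuous function. -/
theorem exists_bcf_integral_add_lt {μ ν : Measure Ω} [IsFiniteMeasure μ] [IsFiniteMeasure ν]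
    (h : μ ⟂ₘ ν) {ε : ℝ} (hε : 0 < ε) :
    ∃ φ : Ω →ᵇ ℝ, (∀ x, φ x ∈ Icc (0 : ℝ) 1) ∧
      ∫ x, φ x ∂ν + ∫ x, (1 - φ x) ∂μ < ε := by
  have hε' : ENNReal.ofReal (ε / 4) ≠ 0 := by simp [hε]
  -- A closed ν-null F carries μ up to ε/4, and an open U ⊇ F has ν-mass below ε/4; φ is a Urysohn
  -- function, 1 on F and 0 off U.
  obtain ⟨F, hFS, hF, hFm⟩ := h.measurableSet_nullSet.compl.exists_isClosed_sdiff_lt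
    (measure_ne_top μ _) hε'
  have hνF : ν F = 0 := measure_mono_null hFS h.measure_compl_nullSet
  obtain ⟨U, hFU, hU, hUm⟩ := F.exists_isOpen_lt_of_lt (μ := ν) (ENNReal.ofReal (ε / 4))
    (by rw [hνF]; exact pos_iff_ne_zero.2 hε')
  obtain ⟨f, hf0, hf1, hf⟩ := exists_continuous_zero_one_of_isClosed hU.isClosed_compl hF
    (disjoint_compl_left_iff_subset.2 hFU)
  let φ : Ω →ᵇ ℝ := BoundedContinuousFunction.ofNormedAddCommGroup f f.continuous 1 fun x => by
    rw [Real.norm_of_nonneg (hf x).1]; exact (hf x).2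
  refine ⟨φ, hf, ?_⟩
  have e1 : ∫ x, φ x ∂ν ≤ ε / 4 := by
    have : ∫ x, φ x ∂ν ≤ ∫ x, U.indicator (fun _ => (1 : ℝ)) x ∂ν := by
      refine integral_mono (φ.integrable ν)
        ((integrable_const _).indicator hU.measurableSet) fun x => ?_
      by_cases hx : x ∈ U
      · simpa [hx] using! (hf x).2
      · simpa [hx] using! (hf0 hx).le
    refine this.trans ?_
    rw [integral_indicator_const _ hU.measurableSet, smul_eq_mul, mul_one]
    exact ENNReal.toReal_le_of_le_ofReal (by positivity) hUm.le
  have hμF : μ Fᶜ ≤ ENNReal.ofReal (ε / 4) := by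
    calc μ Fᶜ ≤ μ (h.nullSet ∪ (h.nullSetᶜ \ F)) :=
          measure_mono fun x hx => by by_cases hS : x ∈ h.nullSet <;> simp_all
      _ ≤ μ h.nullSet + μ (h.nullSetᶜ \ F) := measure_union_le _ _
      _ ≤ ENNReal.ofReal (ε / 4) := by rw [h.measure_nullSet, zero_add]; exact hFm.le
  have e2 : ∫ x, (1 - φ x) ∂μ ≤ ε / 4 := by
    have : ∫ x, (1 - φ x) ∂μ ≤ ∫ x, Fᶜ.indicator (fun _ => (1 : ℝ)) x ∂μ := by
      refine integral_mono ((integrable_const _).sub (φ.integrable μ))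
        ((integrable_const _).indicator hF.measurableSet.compl) fun x => ?_
      by_cases hx : x ∈ F
      · have : φ x = 1 := hf1 hx
        simp [hx, this]
      · have : 0 ≤ φ x := (hf x).1
        simp [hx, this]
    refine this.trans ?_
    rw [integral_indicator_const _ hF.measurableSet.compl, smul_eq_mul, mul_one]
    exact ENNReal.toReal_le_of_le_ofReal (by positivity) hμF
  linarith

/-- The uniform version of `exists_bcf_integral_add_lt` over a compact convex set of probability
measures, by Sion's minimax theorem. -/
theorem exists_bcf_forall_integral_add_lt {μ : Measure Ω} [IsFiniteMeasure μ]
    {K : Set (ProbabilityMeasure Ω)} (hK : IsCompact K)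
    (hconv : ∀ ν₁ ∈ K, ∀ ν₂ ∈ K, ∀ a b : ℝ≥0, a + b = 1 →
      ∃ ν ∈ K, (ν : Measure Ω) = a • (ν₁ : Measure Ω) + b • (ν₂ : Measure Ω))
    (h : ∀ ν ∈ K, μ ⟂ₘ (ν : Measure Ω)) {ε : ℝ} (hε : 0 < ε) :
    ∃ φ : Ω →ᵇ ℝ, (∀ x, φ x ∈ Icc (0 : ℝ) 1) ∧
      ∀ ν ∈ K, ∫ x, φ x ∂(ν : Measure Ω) + ∫ x, (1 - φ x) ∂μ < ε := by
  rcases K.eq_empty_or_nonempty with rfl | hne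
  · exact ⟨0, by simp, by simp⟩
  -- Sion's theorem needs a convex set in a topological vector space, so measures are viewed as
  -- functionals with the product topology.
  let J : ProbabilityMeasure Ω → (Ω →ᵇ ℝ) → ℝ := fun ν φ => ∫ x, φ x ∂(ν : Measure Ω)
  have hJ : Continuous J := continuous_pi fun φ =>
    ProbabilityMeasure.continuous_integral_boundedContinuousFunction φ
  let Y : Set (Ω →ᵇ ℝ) := {φ | ∀ x, φ x ∈ Icc (0 : ℝ) 1}
  have cY : Convex ℝ Y := fun φ hφ ψ hψ a b ha hb hab x =>
    convex_Icc (0 : ℝ) 1 (hφ x) (hψ x) ha hb hab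
  -- The sign makes a good φ one with a large infimum over the measures; f is affine in each
  -- argument on the convex sets used.
  let f : ((Ω →ᵇ ℝ) → ℝ) → (Ω →ᵇ ℝ) → ℝ := fun T φ => -(T φ + ∫ x, (1 - φ x) ∂μ)
  have hμint : ∀ φ : Ω →ᵇ ℝ, ∫ x, (1 - φ x) ∂μ = μ.real univ - ∫ x, φ x ∂μ := fun φ => by
    rw [integral_sub (integrable_const _) (φ.integrable μ)]; simp
  have hμcont : Continuous fun φ : Ω →ᵇ ℝ => ∫ x, (1 - φ x) ∂μ := by
    simp only [hμint]
    exact continuous_const.sub (continuous_integral_bcf μ)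
  have cX : Convex ℝ (J '' K) := by
    rintro _ ⟨ν₁, h₁, rfl⟩ _ ⟨ν₂, h₂, rfl⟩ a b ha hb hab
    lift a to ℝ≥0 using ha
    lift b to ℝ≥0 using hb
    obtain ⟨ν, hν, e⟩ := hconv ν₁ h₁ ν₂ h₂ a b (by exact_mod_cast hab)
    refine ⟨ν, hν, funext fun φ => ?_⟩
    simp only [J, e, Pi.add_apply, Pi.smul_apply]
    rw [integral_add_measure (φ.integrable _) (φ.integrable _),
      integral_smul_nnreal_measure, integral_smul_nnreal_measure]
    rfl
  have hfcont : ∀ φ, Continuous fun T => f T φ := fun φ =>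
    ((continuous_apply φ).add continuous_const).neg
  have hpt : ∀ ν ∈ K, ∃ φ ∈ Y, -ε < f (J ν) φ := fun ν hν => by
    obtain ⟨φ, hφ, hlt⟩ := exists_bcf_integral_add_lt (h ν hν) hε
    exact ⟨φ, hφ, neg_lt_neg hlt⟩
  choose! Φ hΦY hΦ using hpt
  -- By compactness, finitely many of the pointwise separating functions serve all of K; minimax
  -- then merges them into one.
  obtain ⟨t, htK, ht⟩ := hK.elim_nhds_subcover (fun ν => {ν' | -ε < f (J ν') (Φ ν)})
    fun ν hν => (isOpen_lt continuous_const ((hfcont _).comp hJ)).mem_nhds (hΦ ν hν)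
  obtain ⟨φ, hφ, hlt⟩ := Sion.exists_lt_iInf_of_lt_iInf_of_finite (X := J '' K) (Y := Y) (f := f)
    (hne.image J) (hK.image hJ)
    (fun φ _ => (hfcont φ).lowerSemicontinuous.lowerSemicontinuousOn _)
    (fun φ _ => by
      refine ConvexOn.quasiconvexOn ⟨cX, fun T _ T' _ a b _ _ hab => le_of_eq ?_⟩
      simp only [f, Pi.add_apply, Pi.smul_apply, smul_eq_mul]
      linear_combination (∫ x, (1 - φ x) ∂μ) * hab)
    cY
    (by
      rintro _ ⟨ν, _, rfl⟩
      exact ((continuous_integral_bcf _).add hμcont).neg.upperSemicontinuous.upperSemicontinuousOn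
        _)
    (by
      rintro _ ⟨ν, _, rfl⟩
      refine ConcaveOn.quasiconcaveOn ⟨cY, fun φ _ ψ _ a b _ _ hab => le_of_eq ?_⟩
      have hlin : ∀ κ : Measure Ω, IsFiniteMeasure κ → ∫ x, (a • φ + b • ψ) x ∂κ
          = a * ∫ x, φ x ∂κ + b * ∫ x, ψ x ∂κ := fun κ _ => by
        simp only [BoundedContinuousFunction.coe_add, BoundedContinuousFunction.coe_smul,
          Pi.add_apply, smul_eq_mul]
        rw [integral_add ((φ.integrable κ).const_mul a) ((ψ.integrable κ).const_mul b),
          integral_const_mul, integral_const_mul]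
      simp only [f, J, hμint, hlin _ inferInstance, smul_eq_mul]
      linear_combination (-(μ.real univ)) * hab)
    cX (t.finite_toSet.image Φ) (by rintro _ ⟨ν, hν, rfl⟩; exact hΦY ν (htK ν hν)) (t := -ε)
    (by
      rintro _ ⟨ν, hν, rfl⟩
      obtain ⟨ν', hν', hmem⟩ := mem_iUnion₂.1 (ht hν)
      exact ⟨Φ ν', ⟨ν', hν', rfl⟩, hmem⟩)
  exact ⟨φ, hφ, fun ν hν => neg_lt_neg_iff.1 (hlt (J ν) ⟨ν, hν, rfl⟩)⟩

/-- A finite measure that is singular to every member of a compact convex set of probability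
measures is carried by a single Borel set that is null for all of them. -/
theorem exists_measurableSet_forall_null {μ : Measure Ω} [IsFiniteMeasure μ]
    {K : Set (ProbabilityMeasure Ω)} (hK : IsCompact K)
    (hconv : ∀ ν₁ ∈ K, ∀ ν₂ ∈ K, ∀ a b : ℝ≥0, a + b = 1 →
      ∃ ν ∈ K, (ν : Measure Ω) = a • (ν₁ : Measure Ω) + b • (ν₂ : Measure Ω))
    (h : ∀ ν ∈ K, μ ⟂ₘ (ν : Measure Ω)) :
    ∃ E : Set Ω, MeasurableSet E ∧ μ Eᶜ = 0 ∧ ∀ ν ∈ K, (ν : Measure Ω) E = 0 := by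
  rcases K.eq_empty_or_nonempty with rfl | ⟨ν₀, hν₀⟩
  · exact ⟨univ, .univ, by simp, by simp⟩
  have key : ∀ n : ℕ, ∃ φ : Ω →ᵇ ℝ, (∀ x, φ x ∈ Icc (0 : ℝ) 1) ∧
      ∀ ν ∈ K, ∫ x, φ x ∂(ν : Measure Ω) + ∫ x, (1 - φ x) ∂μ < (1 / 2) ^ n := fun n =>
    exists_bcf_forall_integral_add_lt hK hconv h (by positivity)
  choose φ hφ hlt using key
  have hm : ∀ n, Measurable (φ n) := fun n => (φ n).continuous.measurable
  -- Markov's inequality followed by Borel–Cantelli.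
  have markov : ∀ (κ : Measure Ω) [IsFiniteMeasure κ] (g : ℕ → Ω → ℝ),
      (∀ n, Integrable (g n) κ) → (∀ n x, 0 ≤ g n x) → (∀ n, ∫ x, g n x ∂κ ≤ (1 / 2) ^ n) →
      κ (limsup (fun n => {x | 1 / 2 ≤ g n x}) atTop) = 0 := by
    intro κ _ g hg hg0 hgi
    refine measure_limsup_atTop_eq_zero (ne_of_lt ?_)
    have hb : ∀ n, κ {x | 1 / 2 ≤ g n x} ≤ ENNReal.ofReal (2 * (1 / 2) ^ n) := fun n => by
      rw [← ofReal_measureReal]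
      refine ENNReal.ofReal_le_ofReal ?_
      have := mul_meas_ge_le_integral_of_nonneg (ae_of_all κ (hg0 n)) (hg n) (1 / 2)
      linarith [hgi n]
    exact (ENNReal.tsum_le_tsum hb).trans_lt
      (summable_geometric_two.mul_left 2).tsum_ofReal_lt_top
  have hφ0 : ∀ (κ : Measure Ω) n, 0 ≤ ∫ x, φ n x ∂κ := fun κ n =>
    integral_nonneg fun x => (hφ n x).1
  have hφ1 : ∀ (κ : Measure Ω) n, 0 ≤ ∫ x, (1 - φ n x) ∂κ := fun κ n =>
    integral_nonneg fun x => sub_nonneg.2 (hφ n x).2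
  -- Off this set φ n < 1/2 eventually, hence 1 - φ n > 1/2, so `markov` applies to both the set and
  -- its complement.
  refine ⟨limsup (fun n => {x | 1 / 2 ≤ φ n x}) atTop,
    MeasurableSet.measurableSet_limsup fun n => measurableSet_le measurable_const (hm n), ?_, ?_⟩
  · refine measure_mono_null ?_ (markov μ (fun n x => 1 - φ n x)
      (fun n => (integrable_const _).sub ((φ n).integrable μ))
      (fun n x => sub_nonneg.2 (hφ n x).2)
      fun n => by linarith [hlt n ν₀ hν₀, hφ0 (ν₀ : Measure Ω) n])
    intro x hx
    simp only [mem_compl_iff, mem_limsup_iff_frequently_mem, not_frequently, mem_ofPred_eq,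
      not_le] at hx ⊢
    exact (hx.mono fun n hn => by linarith).frequently
  · intro ν hν
    exact markov ν (fun n => φ n) (fun n => (φ n).integrable _) (fun n x => (hφ n x).1)
      fun n => by linarith [hlt n ν hν, hφ1 μ n]

end Separation

/-! ### Characters and Fourier decay bounds -/

variable {d : ℕ}

/-- The character `x ↦ exp(-2πi ξ·x)`. -/
noncomputable def character (ξ x : Space d) : ℂ :=
  Complex.exp (-2 * (Real.pi : ℂ) * Complex.I * ((inner ℝ ξ x : ℝ) : ℂ))

theorem fourierTransform_eq (μ : Measure (Space d)) (ξ : Space d) :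
    fourierTransform μ ξ = ∫ x, character ξ x ∂μ := rfl

theorem norm_character (ξ x : Space d) : ‖character ξ x‖ = 1 := by
  rw [character, show (-2 * (Real.pi : ℂ) * Complex.I * ((inner ℝ ξ x : ℝ) : ℂ))
      = ((-2 * Real.pi * (inner ℝ ξ x : ℝ) : ℝ) : ℂ) * Complex.I by push_cast; ring]
  exact Complex.norm_exp_ofReal_mul_I _

theorem continuous_uncurry_character :
    Continuous fun p : Space d × Space d => character p.1 p.2 := by
  unfold character; fun_prop

theorem continuous_character (ξ : Space d) : Continuous (character ξ) := by
  unfold character; fun_prop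

theorem character_add_left (ξ η x : Space d) :
    character (ξ + η) x = character ξ x * character η x := by
  simp only [character, inner_add_left, ← Complex.exp_add]
  congr 1; push_cast; ring

theorem integrable_character (μ : Measure (Space d)) [IsFiniteMeasure μ] (ξ : Space d) :
    Integrable (character ξ) μ :=
  (integrable_const (1 : ℝ)).mono' (continuous_character ξ).aestronglyMeasurable
    (ae_of_all _ fun x => (norm_character ξ x).le)

/-- The Fourier decay bound with an explicit constant. -/
def FourierBound (μ : Measure (Space d)) (s C : ℝ) : Prop :=
  ∀ ξ : Space d, ξ ≠ 0 → ‖fourierTransform μ ξ‖ ≤ C * ‖ξ‖ ^ (-s / 2)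

theorem FourierBound.hasFourierDecay {μ : Measure (Space d)} {s C : ℝ} (h : FourierBound μ s C) :
    HasFourierDecay μ s := ⟨C, h⟩

theorem FourierBound.mono {μ : Measure (Space d)} {s C C' : ℝ} (h : FourierBound μ s C)
    (hC : C ≤ C') : FourierBound μ s C' := fun ξ hξ =>
  (h ξ hξ).trans (mul_le_mul_of_nonneg_right hC (by positivity))

theorem fourierTransform_smul (c : ℝ≥0∞) (μ : Measure (Space d)) (ξ : Space d) :
    fourierTransform (c • μ) ξ = c.toReal * fourierTransform μ ξ := by
  simp [fourierTransform, integral_smul_measure]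

theorem FourierBound.smul {μ : Measure (Space d)} {s C : ℝ} (h : FourierBound μ s C) (c : ℝ≥0∞) :
    FourierBound (c • μ) s (c.toReal * C) := fun ξ hξ => by
  rw [fourierTransform_smul, norm_mul, mul_assoc, Complex.norm_real,
    Real.norm_of_nonneg ENNReal.toReal_nonneg]
  exact mul_le_mul_of_nonneg_left (h ξ hξ) ENNReal.toReal_nonneg

/-- Countably many measures with Fourier decay are dominated by a single one. -/
theorem exists_dominating_hasFourierDecay {s : ℝ} (κ : ℕ → Measure (Space d))
    [hfin : ∀ n, IsFiniteMeasure (κ n)] (h : ∀ n, HasFourierDecay (κ n) s) :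
    ∃ κ' : Measure (Space d), IsFiniteMeasure κ' ∧ HasFourierDecay κ' s ∧ ∀ n, κ n ≪ κ' := by
  choose C hC using h
  have hpos : ∀ n, 0 < 1 + |C n| + (κ n).real univ := fun n => by positivity
  -- These weights make both the total masses and the decay constants sum to at most 2.
  let r : ℕ → ℝ := fun n => (1 / 2) ^ n / (1 + |C n| + (κ n).real univ)
  have hr : ∀ n, 0 < r n := fun n => div_pos (by positivity) (hpos n)
  let w : ℕ → ℝ≥0∞ := fun n => ENNReal.ofReal (r n)
  have hw : ∀ n, (w n).toReal = r n := fun n => ENNReal.toReal_ofReal (hr n).le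
  have hle : ∀ n a, a ≤ 1 + |C n| + (κ n).real univ → r n * a ≤ (1 / 2) ^ n := fun n a ha => by
    rw [div_mul_eq_mul_div, div_le_iff₀ (hpos n)]
    exact mul_le_mul_of_nonneg_left ha (by positivity)
  have hmass : ∀ n, (w n • κ n) univ ≤ ENNReal.ofReal ((1 / 2) ^ n) := fun n => by
    rw [Measure.smul_apply, smul_eq_mul, ← ofReal_measureReal (μ := κ n),
      ← ENNReal.ofReal_mul (hr n).le]
    exact ENNReal.ofReal_le_ofReal (hle n _ (by linarith [abs_nonneg (C n)]))
  have : IsFiniteMeasure (Measure.sum fun n => w n • κ n) := ⟨by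
    rw [Measure.sum_apply _ MeasurableSet.univ]
    exact (ENNReal.tsum_le_tsum hmass).trans_lt summable_geometric_two.tsum_ofReal_lt_top⟩
  refine ⟨Measure.sum fun n => w n • κ n, this, ⟨2, fun ξ hξ => ?_⟩, fun n => ?_⟩
  · rw [fourierTransform_eq, integral_sum_measure (integrable_character _ ξ)]
    refine tsum_of_norm_bounded (hasSum_geometric_two.mul_right _) fun n => ?_
    rw [← fourierTransform_eq]
    refine ((FourierBound.smul (hC n) (w n)) ξ hξ).trans ?_
    rw [hw]
    exact mul_le_mul_of_nonneg_right
      (hle n _ (by linarith [le_abs_self (C n), measureReal_nonneg (μ := κ n) (s := univ)]))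
      (by positivity)
  · refine Measure.AbsolutelyContinuous.trans ?_ (Measure.le_sum _ n).absolutelyContinuous
    exact Measure.absolutelyContinuous_smul (by simpa [w] using hr n)

theorem exists_probabilityMeasure_eq_smul {κ : Measure (Space d)} [IsFiniteMeasure κ]
    (h : κ ≠ 0) :
    ∃ ν : ProbabilityMeasure (Space d), (ν : Measure (Space d)) = (κ univ)⁻¹ • κ :=
  have : NeZero κ := ⟨h⟩
  ⟨⟨(κ univ)⁻¹ • κ, inferInstance⟩, rfl⟩

/-! ### Multiplication by a Gaussian -/

/-- The Gaussian `exp(-π|x|²)`. -/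
noncomputable def gaussian (x : Space d) : ℝ := Real.exp (-Real.pi * ‖x‖ ^ 2)

theorem gaussian_pos (x : Space d) : 0 < gaussian x := Real.exp_pos _

theorem continuous_gaussian : Continuous (gaussian (d := d)) := by
  unfold gaussian; fun_prop

theorem integrable_exp_neg_mul_sq {b : ℝ} (hb : 0 < b) :
    Integrable fun x : Space d => Real.exp (-b * ‖x‖ ^ 2) := by
  have h := (GaussianFourier.integrable_cexp_neg_mul_sq_norm_add (b := (b : ℂ))
    (by simpa using hb) 0 (0 : Space d)).norm
  refine h.congr (ae_of_all _ fun x => ?_)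
  simp only [Complex.norm_exp]
  congr 1
  rw [zero_mul, add_zero]
  norm_cast

theorem integrable_gaussian : Integrable (gaussian (d := d)) :=
  integrable_exp_neg_mul_sq Real.pi_pos

/-- The Gaussian is its own Fourier transform; as a superposition of characters it acts on measures
by shifting frequencies. -/
theorem gaussian_eq_integral (x : Space d) :
    (gaussian x : ℂ) = ∫ η : Space d, (gaussian η : ℂ) * character η x := by
  have h := GaussianFourier.integral_cexp_neg_mul_sq_norm_add (b := (Real.pi : ℂ))
    (by simpa using Real.pi_pos) (-2 * (Real.pi : ℂ) * Complex.I) x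
  have hpi : (Real.pi : ℂ) ≠ 0 := by exact_mod_cast Real.pi_ne_zero
  rw [div_self hpi, Complex.one_cpow, one_mul] at h
  have e : (gaussian x : ℂ)
      = Complex.exp ((-2 * (Real.pi : ℂ) * Complex.I) ^ 2 * ‖x‖ ^ 2 / (4 * Real.pi)) := by
    rw [gaussian, Complex.ofReal_exp]
    congr 1
    push_cast
    rw [mul_pow, mul_pow, Complex.I_sq]
    field_simp
    ring
  rw [e, ← h]
  refine integral_congr_ae (ae_of_all _ fun η => ?_)
  simp only [gaussian, character, Complex.ofReal_exp, ← Complex.exp_add]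
  rw [real_inner_comm]
  push_cast
  rfl

/-- Makes finite the constant in `hasFourierDecay_gaussianWeight`, where a frequency shift η costs a
factor of order ‖η‖ ^ (s / 2). -/
theorem integrable_rpow_mul_gaussian {p : ℝ} (hp : 0 ≤ p) :
    Integrable fun x : Space d => ‖x‖ ^ p * gaussian x := by
  set k := ⌈p⌉₊
  refine ((integrable_exp_neg_mul_sq (d := d) one_pos).const_mul (k.factorial * Real.exp 2)).mono'
    ?_ (ae_of_all _ fun x => ?_)
  · exact ((continuous_norm.rpow_const fun _ => Or.inr hp).mul
      continuous_gaussian).aestronglyMeasurable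
  · have hx := norm_nonneg x
    rw [Real.norm_of_nonneg (mul_nonneg (by positivity) (gaussian_pos x).le)]
    have h1 : ‖x‖ ^ p ≤ k.factorial * Real.exp (2 + ‖x‖ ^ 2) := by
      calc ‖x‖ ^ p ≤ (1 + ‖x‖) ^ p := Real.rpow_le_rpow hx (by linarith) hp
        _ ≤ (1 + ‖x‖) ^ (k : ℝ) := Real.rpow_le_rpow_of_exponent_le (by linarith) (Nat.le_ceil p)
        _ = (1 + ‖x‖) ^ k := Real.rpow_natCast _ _
        _ ≤ k.factorial * Real.exp (1 + ‖x‖) := by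
          have := Real.pow_div_factorial_le_exp (1 + ‖x‖) (by linarith) k
          rwa [div_le_iff₀ (by positivity), mul_comm] at this
        _ ≤ k.factorial * Real.exp (2 + ‖x‖ ^ 2) := by
          gcongr k.factorial * Real.exp ?_
          nlinarith [sq_nonneg (‖x‖ - 1)]
    calc ‖x‖ ^ p * gaussian x
        ≤ k.factorial * Real.exp (2 + ‖x‖ ^ 2) * gaussian x :=
          mul_le_mul_of_nonneg_right h1 (gaussian_pos x).le
      _ = k.factorial * Real.exp (2 + ‖x‖ ^ 2 + -Real.pi * ‖x‖ ^ 2) := by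
          rw [gaussian, mul_assoc, ← Real.exp_add]
      _ ≤ k.factorial * Real.exp (2 + -1 * ‖x‖ ^ 2) := by
          gcongr k.factorial * Real.exp ?_
          nlinarith [Real.two_le_pi, sq_nonneg ‖x‖]
      _ = k.factorial * Real.exp 2 * Real.exp (-1 * ‖x‖ ^ 2) := by rw [Real.exp_add]; ring

/-- The measure `exp(-π|x|²) dν(x)`. -/
noncomputable def gaussianWeight (ν : Measure (Space d)) : Measure (Space d) :=
  ν.withDensity fun x => ENNReal.ofReal (gaussian x)

theorem measurable_ofReal_gaussian :
    Measurable fun x : Space d => ENNReal.ofReal (gaussian x) :=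
  continuous_gaussian.measurable.ennreal_ofReal

theorem gaussian_le_one (x : Space d) : gaussian x ≤ 1 :=
  Real.exp_le_one_iff.2 (by nlinarith [Real.pi_pos, sq_nonneg ‖x‖])

theorem gaussianWeight_le (ν : Measure (Space d)) : gaussianWeight ν ≤ ν := by
  conv_rhs => rw [← withDensity_one (μ := ν)]
  exact withDensity_mono (ae_of_all _ fun x => by simpa using gaussian_le_one x)

instance (ν : Measure (Space d)) [IsFiniteMeasure ν] : IsFiniteMeasure (gaussianWeight ν) :=
  isFiniteMeasure_of_le ν (gaussianWeight_le ν)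

theorem absolutelyContinuous_gaussianWeight (ν : Measure (Space d)) : ν ≪ gaussianWeight ν :=
  withDensity_absolutelyContinuous' measurable_ofReal_gaussian.aemeasurable
    (ae_of_all _ fun x => by simpa using gaussian_pos x)

theorem fourierTransform_gaussianWeight (ν : Measure (Space d)) [IsFiniteMeasure ν]
    (ξ : Space d) :
    fourierTransform (gaussianWeight ν) ξ
      = ∫ η : Space d, (gaussian η : ℂ) * fourierTransform ν (ξ + η) := by
  have h1 : fourierTransform (gaussianWeight ν) ξ
      = ∫ x, ∫ η : Space d, (gaussian η : ℂ) * character (ξ + η) x ∂volume ∂ν := by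
    rw [fourierTransform_eq, gaussianWeight, integral_withDensity_eq_integral_toReal_smul
      measurable_ofReal_gaussian (ae_of_all _ fun _ => ENNReal.ofReal_lt_top)]
    refine integral_congr_ae (ae_of_all _ fun x => ?_)
    simp only
    rw [ENNReal.toReal_ofReal (gaussian_pos x).le, Complex.real_smul, gaussian_eq_integral,
      ← integral_mul_const]
    refine integral_congr_ae (ae_of_all _ fun η => ?_)
    simp only [character_add_left]
    ring
  rw [h1, integral_integral_swap]
  · simp only [integral_const_mul, fourierTransform_eq]
  · refine ((integrable_const (1 : ℝ)).mul_prod (μ := ν) integrable_gaussian).mono'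
      (Continuous.aestronglyMeasurable ?_) (ae_of_all _ fun p => ?_)
    · refine (Complex.continuous_ofReal.comp (continuous_gaussian.comp continuous_snd)).mul ?_
      exact continuous_uncurry_character.comp
        ((continuous_const.add continuous_snd).prodMk continuous_fst)
    · simp [Function.uncurry, norm_character, abs_of_pos (gaussian_pos p.2)]

/-- If ‖η‖ ≤ ‖ξ‖ / 2, the shifted frequency still has size at least ‖ξ‖ / 2 and the decay of ν
applies. Otherwise 2‖η‖ / ‖ξ‖ ≥ 1 and the trivial bound 1 suffices. -/
theorem norm_fourierTransform_add_le {ν : Measure (Space d)} [IsProbabilityMeasure ν] {s C : ℝ}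
    (hs : 0 ≤ s) (hC : 0 ≤ C) (h : FourierBound ν s C) {ξ : Space d} (hξ : ξ ≠ 0) (η : Space d) :
    ‖fourierTransform ν (ξ + η)‖ ≤ 2 ^ (s / 2) * (C + ‖η‖ ^ (s / 2)) * ‖ξ‖ ^ (-s / 2) := by
  have hξ' : 0 < ‖ξ‖ := norm_pos_iff.2 hξ
  rw [mul_add, add_mul]
  rcases le_total ‖η‖ (‖ξ‖ / 2) with hη | hη
  · have hn : ‖ξ‖ / 2 ≤ ‖ξ + η‖ := by
      have := norm_sub_le_norm_add ξ η
      linarith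
    have hne : ξ + η ≠ 0 := norm_pos_iff.1 (lt_of_lt_of_le (by positivity) hn)
    have : ‖fourierTransform ν (ξ + η)‖ ≤ 2 ^ (s / 2) * C * ‖ξ‖ ^ (-s / 2) := by
      calc _ ≤ C * ‖ξ + η‖ ^ (-s / 2) := h _ hne
        _ ≤ C * (‖ξ‖ / 2) ^ (-s / 2) := by
          gcongr C * ?_
          exact Real.rpow_le_rpow_of_nonpos (by positivity) hn (by linarith)
        _ = _ := by
          rw [Real.div_rpow hξ'.le (by norm_num), neg_div, Real.rpow_neg (by norm_num : (0:ℝ) ≤ 2)]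
          field_simp
    have h2 : 0 ≤ (2 : ℝ) ^ (s / 2) * ‖η‖ ^ (s / 2) * ‖ξ‖ ^ (-s / 2) := by positivity
    linarith
  · have : ‖fourierTransform ν (ξ + η)‖ ≤ 2 ^ (s / 2) * ‖η‖ ^ (s / 2) * ‖ξ‖ ^ (-s / 2) := by
      calc _ ≤ 1 := by simpa using norm_fourierTransform_le ν (ξ + η)
        _ ≤ (2 * ‖η‖ / ‖ξ‖) ^ (s / 2) :=
          Real.one_le_rpow ((one_le_div hξ').2 (by linarith)) (by linarith)
        _ = _ := by
          rw [Real.div_rpow (by positivity) hξ'.le, Real.mul_rpow (by norm_num) (norm_nonneg _),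
            neg_div, Real.rpow_neg hξ'.le, div_eq_mul_inv]
    have h2 : 0 ≤ (2 : ℝ) ^ (s / 2) * C * ‖ξ‖ ^ (-s / 2) := by positivity
    linarith

/-- Multiplication by a Gaussian preserves Fourier decay. -/
theorem hasFourierDecay_gaussianWeight {ν : Measure (Space d)} [IsProbabilityMeasure ν] {s : ℝ}
    (hs : 0 ≤ s) (h : HasFourierDecay ν s) : HasFourierDecay (gaussianWeight ν) s := by
  obtain ⟨C, hC⟩ := h
  have hC' : FourierBound ν s |C| := FourierBound.mono hC (le_abs_self C)
  refine ⟨∫ η : Space d, 2 ^ (s / 2) * (|C| * gaussian η + ‖η‖ ^ (s / 2) * gaussian η),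
    fun ξ hξ => ?_⟩
  rw [fourierTransform_gaussianWeight, ← integral_mul_const]
  refine norm_integral_le_of_norm_le ((((integrable_gaussian.const_mul _).add
    (integrable_rpow_mul_gaussian (by linarith))).const_mul _).mul_const _)
    (ae_of_all _ fun η => ?_)
  rw [norm_mul, Complex.norm_real, Real.norm_of_nonneg (gaussian_pos η).le]
  refine (mul_le_mul_of_nonneg_left (norm_fourierTransform_add_le hs (abs_nonneg C) hC' hξ η)
    (gaussian_pos η).le).trans (le_of_eq ?_)
  ring

/-- The bound is independent of ν, which is what gives uniform tightness. -/
theorem gaussianWeight_compl_closedBall_le (ν : Measure (Space d)) [IsProbabilityMeasure ν]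
    (n : ℕ) :
    gaussianWeight ν (Metric.closedBall 0 n)ᶜ ≤ ENNReal.ofReal (1 / (n + 1)) := by
  have hm : MeasurableSet (Metric.closedBall (0 : Space d) n)ᶜ := measurableSet_closedBall.compl
  rw [gaussianWeight, withDensity_apply _ hm]
  calc _ ≤ ∫⁻ _ in (Metric.closedBall (0 : Space d) n)ᶜ, ENNReal.ofReal (1 / (n + 1)) ∂ν := by
        refine setLIntegral_mono measurable_const fun x hx => ENNReal.ofReal_le_ofReal ?_
        have hx' : (n : ℝ) < ‖x‖ := by simpa using hx
        have hn : (n : ℝ) ≤ (n : ℝ) ^ 2 := by exact_mod_cast Nat.le_self_pow two_ne_zero n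
        have hn0 : (0 : ℝ) ≤ n := n.cast_nonneg
        have h1 : (n : ℝ) + 1 ≤ Real.exp (Real.pi * ‖x‖ ^ 2) := by
          refine le_trans ?_ (Real.add_one_le_exp _)
          have : (n : ℝ) ^ 2 ≤ ‖x‖ ^ 2 := by gcongr
          nlinarith [Real.two_le_pi]
        rw [gaussian, neg_mul, Real.exp_neg, ← one_div]
        exact one_div_le_one_div_of_le (by positivity) h1
    _ ≤ ENNReal.ofReal (1 / (n + 1)) := by
        rw [setLIntegral_const]
        exact mul_le_of_le_one_right zero_le prob_le_one

/-! ### Compact convex classes of measures with decay -/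

/-- The probability measures with Fourier decay of constant `C` and with quantified tails. -/
def decayClass (d : ℕ) (s : ℝ) (C : ℝ≥0) : Set (ProbabilityMeasure (Space d)) :=
  {ν | (∀ n : ℕ, ν (Metric.closedBall 0 n)ᶜ ≤ C * (1 / ((n : ℝ≥0) + 1))) ∧
    FourierBound (ν : Measure (Space d)) s C}

theorem continuous_fourierTransform (ξ : Space d) :
    Continuous fun ν : ProbabilityMeasure (Space d) =>
      fourierTransform (ν : Measure (Space d)) ξ := by
  let φ : Space d →ᵇ ℂ := BoundedContinuousFunction.ofNormedAddCommGroup (character ξ)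
    (continuous_character ξ) 1 fun x => (norm_character ξ x).le
  exact continuous_iff_continuousAt.2 fun ν =>
    (ProbabilityMeasure.tendsto_iff_forall_integral_rclike_tendsto ℂ).1 tendsto_id φ

/-- The tail bounds give tightness, hence compactness by Prokhorov's theorem. The decay bound is
closed because each Fourier coefficient is weakly continuous. -/
theorem isCompact_decayClass (s : ℝ) (C : ℝ≥0) : IsCompact (decayClass d s C) := by
  have hu : Tendsto (fun n : ℕ => C * (1 / ((n : ℝ≥0) + 1))) atTop (𝓝 0) := by
    simpa using tendsto_one_div_add_atTop_nhds_zero_nat (𝕜 := ℝ≥0) |>.const_mul C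
  refine (isCompact_setOfPred_probabilityMeasure_mass_eq_compl_isCompact_le hu
    (fun n => isCompact_closedBall (0 : Space d) n) (Or.inl inferInstance)).inter_right
    (t := {ν : ProbabilityMeasure (Space d) | FourierBound (ν : Measure (Space d)) s C}) ?_
  simp only [FourierBound, ofPred_forall]
  exact isClosed_iInter fun ξ => isClosed_iInter fun _ =>
    isClosed_le (continuous_fourierTransform ξ).norm continuous_const

theorem decayClass_convex (s : ℝ) (C : ℝ≥0) :
    ∀ ν₁ ∈ decayClass d s C, ∀ ν₂ ∈ decayClass d s C, ∀ a b : ℝ≥0, a + b = 1 →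
      ∃ ν ∈ decayClass d s C, (ν : Measure (Space d))
        = a • (ν₁ : Measure (Space d)) + b • (ν₂ : Measure (Space d)) := by
  intro ν₁ h₁ ν₂ h₂ a b hab
  have hp : IsProbabilityMeasure (a • (ν₁ : Measure (Space d)) + b • (ν₂ : Measure (Space d))) :=
    ⟨by
      simp only [Measure.add_apply, Measure.smul_apply, measure_univ]
      simp only [ENNReal.smul_def, smul_eq_mul, mul_one]
      exact_mod_cast hab⟩
  obtain ⟨ν, hν⟩ : ∃ ν : ProbabilityMeasure (Space d), (ν : Measure (Space d))
      = a • (ν₁ : Measure (Space d)) + b • (ν₂ : Measure (Space d)) := ⟨⟨_, hp⟩, rfl⟩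
  refine ⟨ν, ⟨fun n => ?_, fun ξ hξ => ?_⟩, hν⟩
  · rw [← ENNReal.coe_le_coe, ProbabilityMeasure.ennreal_coeFn_eq_coeFn_toMeasure]
    have e₁ := ENNReal.coe_le_coe.2 (h₁.1 n)
    have e₂ := ENNReal.coe_le_coe.2 (h₂.1 n)
    rw [ProbabilityMeasure.ennreal_coeFn_eq_coeFn_toMeasure] at e₁ e₂
    simp only [hν, Measure.add_apply, Measure.smul_apply, ENNReal.smul_def, smul_eq_mul]
    refine (add_le_add (mul_le_mul_right e₁ _) (mul_le_mul_right e₂ _)).trans (le_of_eq ?_)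
    rw [← add_mul, ← ENNReal.coe_add, hab, ENNReal.coe_one, one_mul]
  · have hab' : (a : ℝ) + b = 1 := by exact_mod_cast hab
    rw [hν, fourierTransform_eq,
      integral_add_measure (integrable_character _ ξ) (integrable_character _ ξ),
      integral_smul_nnreal_measure, integral_smul_nnreal_measure]
    refine (norm_add_le _ _).trans ?_
    simp only [NNReal.smul_def, norm_smul, Real.norm_of_nonneg NNReal.zero_le_coe]
    have e₁ := mul_le_mul_of_nonneg_left (h₁.2 ξ hξ) a.2
    have e₂ := mul_le_mul_of_nonneg_left (h₂.2 ξ hξ) b.2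
    refine (add_le_add e₁ e₂).trans (le_of_eq ?_)
    simp only [NNReal.val_eq_coe]
    linear_combination (C * ‖ξ‖ ^ (-s / 2)) * hab'

/-- The witness is the normalized Gaussian weight of ν. Taking C natural leaves only countably many
classes to treat. -/
theorem exists_mem_decayClass {s : ℝ} (hs : 0 ≤ s) (ν : ProbabilityMeasure (Space d))
    (h : HasFourierDecay (ν : Measure (Space d)) s) :
    ∃ C : ℕ, ∃ ν' ∈ decayClass d s C, (ν : Measure (Space d)) ≪ (ν' : Measure (Space d)) := by
  set κ := gaussianWeight (ν : Measure (Space d))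
  have hac : (ν : Measure (Space d)) ≪ κ := absolutelyContinuous_gaussianWeight _
  have hκ : κ ≠ 0 := fun h0 => by
    rw [h0, Measure.absolutelyContinuous_zero_iff] at hac
    exact IsProbabilityMeasure.ne_zero (ν : Measure (Space d)) hac
  obtain ⟨D, hD⟩ := hasFourierDecay_gaussianWeight hs h
  obtain ⟨ν', hν'⟩ := exists_probabilityMeasure_eq_smul hκ
  have hm : (κ univ)⁻¹ ≠ ∞ := ENNReal.inv_ne_top.2 (by simpa using hκ)
  set m : ℝ≥0 := ((κ univ)⁻¹).toNNReal
  have hm' : (κ univ)⁻¹ = m := (ENNReal.coe_toNNReal hm).symm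
  obtain ⟨C, hC⟩ := exists_nat_ge (max (m : ℝ) (m * D))
  have hCm : m ≤ C := by exact_mod_cast (le_max_left _ _).trans hC
  refine ⟨C, ν', ⟨fun n => ?_, ?_⟩, ?_⟩
  · rw [← ENNReal.coe_le_coe, ProbabilityMeasure.ennreal_coeFn_eq_coeFn_toMeasure, hν', hm',
      Measure.smul_apply, smul_eq_mul, ENNReal.coe_mul]
    refine mul_le_mul' (by exact_mod_cast hCm)
      ((gaussianWeight_compl_closedBall_le _ n).trans (le_of_eq ?_))
    rw [ENNReal.ofReal]
    congr 1
    ext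
    rw [Real.coe_toNNReal _ (by positivity)]
    push_cast
    rfl
  · rw [hν', hm']
    refine (FourierBound.smul hD m).mono ?_
    simpa using (le_max_right _ _).trans hC
  · rw [hν']
    exact hac.trans (Measure.absolutelyContinuous_smul (by simp))

/-! ### Decomposition of a measure and the bidual of `classC` -/

/-- A finite measure splits along a Borel set into a part dominated by a measure with Fourier
decay and a part singular to every such measure. -/
theorem exists_measurableSet_restrict_singular (μ : Measure (Space d)) [IsFiniteMeasure μ]
    (s : ℝ) :
    ∃ A : Set (Space d), MeasurableSet A ∧
      (∃ κ : Measure (Space d), IsFiniteMeasure κ ∧ HasFourierDecay κ s ∧ μ.restrict A ≪ κ) ∧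
      ∀ ν : Measure (Space d), IsFiniteMeasure ν → HasFourierDecay ν s → μ.restrict Aᶜ ⟂ₘ ν := by
  let F : Set (Set (Space d)) := {A | MeasurableSet A ∧
    ∃ κ : Measure (Space d), IsFiniteMeasure κ ∧ HasFourierDecay κ s ∧ μ.restrict A ≪ κ}
  have hU : ∀ A : ℕ → Set (Space d), (∀ n, A n ∈ F) → (⋃ n, A n) ∈ F := fun A hA => by
    choose hm κ hfin hdec hac using hA
    obtain ⟨κ', hfin', hdec', hac'⟩ := exists_dominating_hasFourierDecay κ hdec
    refine ⟨.iUnion hm, κ', hfin', hdec', ?_⟩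
    exact Measure.absolutelyContinuous_of_le Measure.restrict_iUnion_le |>.trans
      (Measure.absolutelyContinuous_sum_left fun n => (hac n).trans (hac' n))
  have h0 : ∅ ∈ F := by
    refine ⟨.empty, 0, inferInstance, ⟨0, fun ξ _ => ?_⟩, ?_⟩
    · simp [fourierTransform]
    · simp
  have hne : (μ '' F).Nonempty := ⟨_, ∅, h0, rfl⟩
  -- The union of a maximizing sequence stays in F by `hU`, so it attains the largest μ-measure in
  -- F.
  obtain ⟨u, -, hu, huF⟩ := exists_seq_tendsto_sSup hne (OrderTop.bddAbove _)
  choose A hAF hA using huF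
  obtain ⟨hAm, hAκ⟩ := hU A hAF
  have hmax : ∀ B ∈ F, μ B ≤ μ (⋃ n, A n) := fun B hB =>
    (le_sSup (mem_image_of_mem μ hB)).trans <| le_of_tendsto' hu fun n => by
      rw [← hA n]; exact measure_mono (subset_iUnion A n)
  refine ⟨_, hAm, hAκ, fun ν hν hdec => ?_⟩
  have hsing := Measure.mutuallySingular_singularPart μ ν
  set S := hsing.nullSet
  have hS : MeasurableSet S := hsing.measurableSet_nullSet
  -- On S the singular part of μ vanishes, so there μ ≪ ν. Maximality then makes S null for μ off
  -- the union, while Sᶜ is ν-null.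
  have hSF : S ∈ F := by
    refine ⟨hS, ν, hν, hdec, ?_⟩
    have := Measure.haveLebesgueDecomposition_of_sigmaFinite μ ν
    rw [μ.haveLebesgueDecomposition_add ν, Measure.restrict_add,
      Measure.restrict_eq_zero.2 hsing.measure_nullSet, zero_add]
    exact Measure.restrict_le_self.absolutelyContinuous.trans
      (withDensity_absolutelyContinuous _ _)
  have hdiff : μ (S \ ⋃ n, A n) = 0 := by
    have hUF : (⋃ n, A n) ∪ S ∈ F := by
      have := hU (fun n => if n = 0 then ⋃ n, A n else S) fun n => by
        by_cases h : n = 0 <;> simp only [h, if_true, if_false]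
        · exact ⟨hAm, hAκ⟩
        · exact hSF
      convert this using 1
      ext x
      simp only [mem_union, mem_iUnion (s := fun n => if n = 0 then ⋃ n, A n else S)]
      constructor
      · rintro (h | h)
        · exact ⟨0, by simpa using h⟩
        · exact ⟨1, by simpa using h⟩
      · rintro ⟨n, hn⟩
        by_cases h : n = 0 <;> simp only [h, if_true, if_false] at hn
        · exact Or.inl hn
        · exact Or.inr hn
    have hle := hmax _ hUF
    rw [← union_sdiff_self, measure_union disjoint_sdiff_right (hS.diff hAm)] at hle
    by_contra h
    exact (ENNReal.lt_add_right (measure_ne_top μ _) h).not_ge hle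
  refine ⟨S, hS, ?_, hsing.measure_compl_nullSet⟩
  rw [Measure.restrict_apply hS]
  exact hdiff

theorem annihilators_nullSets_classC (d : ℕ) {s : ℝ} (hs : 0 ≤ s) :
    annihilators (nullSets (classC d s)) = classC d s := by
  refine Subset.antisymm (fun μ hμ => ?_) fun μ hμ E hE => hE.2 μ hμ
  obtain ⟨A, hA, ⟨κ, hκ, hdec, hac⟩, hsing⟩ :=
    exists_measurableSet_restrict_singular (μ : Measure (Space d)) s
  have hC : ∀ C : ℕ, ∃ E : Set (Space d), MeasurableSet E ∧
      (μ : Measure (Space d)).restrict Aᶜ Eᶜ = 0 ∧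
      ∀ ν ∈ decayClass d s C, (ν : Measure (Space d)) E = 0 := fun C =>
    exists_measurableSet_forall_null (isCompact_decayClass s C) (decayClass_convex s C)
      fun ν hν => hsing ν inferInstance hν.2.hasFourierDecay
  choose E hE hμE hνE using hC
  -- Each ν in the class is dominated by a member of some `decayClass`, for which already the single
  -- set E C is null.
  have hmem : (⋂ C, E C) ∈ nullSets (classC d s) := by
    refine ⟨.iInter hE, fun ν hν => ?_⟩
    obtain ⟨ν₁, hac₁, hdec₁⟩ := hν
    obtain ⟨C, ν₂, hν₂, hac₂⟩ := exists_mem_decayClass hs ν₁ hdec₁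
    exact hac₁ (hac₂ (measure_mono_null (iInter_subset E C) (hνE C ν₂ hν₂)))
  have hAc : (μ : Measure (Space d)) Aᶜ = 0 := by
    have h1 : (μ : Measure (Space d)).restrict Aᶜ (⋂ C, E C) = 0 :=
      Measure.restrict_le_self.absolutelyContinuous (hμ _ hmem)
    have h2 : (μ : Measure (Space d)).restrict Aᶜ (⋂ C, E C)ᶜ = 0 := by
      rw [compl_iInter]
      exact measure_iUnion_null hμE
    rw [← Measure.restrict_apply_univ, ← union_compl_self (⋂ C, E C)]
    exact measure_union_null h1 h2
  rw [Measure.restrict_eq_self_of_ae_mem (mem_ae_iff.2 hAc)] at hac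
  have hκ0 : κ ≠ 0 := fun h0 => by
    rw [h0, Measure.absolutelyContinuous_zero_iff] at hac
    exact IsProbabilityMeasure.ne_zero (μ : Measure (Space d)) hac
  obtain ⟨ν, hν⟩ := exists_probabilityMeasure_eq_smul hκ0
  refine ⟨ν, ?_, ?_⟩
  · rw [hν]
    exact hac.trans (Measure.absolutelyContinuous_smul (by simp))
  · obtain ⟨C, hC⟩ := hdec
    rw [hν]
    exact (FourierBound.smul hC _).hasFourierDecay

/-! ### Modified Fourier dimension and the bidual of `classM` -/

/-- For ‖ξ‖ ≥ 1 the powers compare directly; for ‖ξ‖ ≤ 1 the total mass is a sufficient bound, since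
‖ξ‖ ^ (-s / 2) ≥ 1. -/
theorem HasFourierDecay.anti {μ : Measure (Space d)} {s t : ℝ}
    (h : HasFourierDecay μ t) (hs : 0 ≤ s) (hst : s ≤ t) : HasFourierDecay μ s := by
  obtain ⟨C, hC⟩ := h
  refine ⟨max |C| (μ.real univ), fun ξ hξ => ?_⟩
  have hξ' : 0 < ‖ξ‖ := norm_pos_iff.2 hξ
  rcases le_total 1 ‖ξ‖ with h1 | h1
  · calc _ ≤ C * ‖ξ‖ ^ (-t / 2) := hC ξ hξ
      _ ≤ |C| * ‖ξ‖ ^ (-t / 2) := by gcongr; exact le_abs_self C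
      _ ≤ max |C| (μ.real univ) * ‖ξ‖ ^ (-s / 2) := by
        gcongr
        exact le_max_left _ _
  · calc _ ≤ μ.real univ := norm_fourierTransform_le μ ξ
      _ ≤ max |C| (μ.real univ) * 1 := by rw [mul_one]; exact le_max_right _ _
      _ ≤ max |C| (μ.real univ) * ‖ξ‖ ^ (-s / 2) := by
        gcongr
        exact Real.one_le_rpow_of_pos_of_le_one_of_nonpos hξ' h1 (by linarith)

/-- The suprema defining the dimensions need not be attained, but any t strictly below s is exceeded
by actual witnesses. -/
theorem mem_classM_iff {s : ℝ} (hs : 0 ≤ s) (hsd : s ≤ d) (μ : ProbabilityMeasure (Space d)) :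
    μ ∈ classM d s ↔ ∀ t, 0 ≤ t → t < s → μ ∈ classC d t := by
  constructor
  · intro hμ t ht hts
    have hlt : t < dimFM (μ : Measure (Space d)) := lt_of_lt_of_le hts hμ
    obtain ⟨_, ⟨ν, hac, rfl⟩, hlt⟩ := exists_lt_of_lt_csSup
      (by exact ⟨_, μ, Measure.AbsolutelyContinuous.rfl, rfl⟩) hlt
    obtain ⟨r, ⟨-, hr⟩, htr⟩ := exists_lt_of_lt_csSup
      (by exact ⟨0, ⟨le_rfl, d.cast_nonneg⟩, hasFourierDecay_zero _⟩) hlt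
    exact ⟨ν, hac, hr.anti ht htr.le⟩
  · intro h
    rcases hs.eq_or_lt with rfl | hs'
    · exact (dimFM_mem_Icc μ).2.1
    change s ≤ dimFM (μ : Measure (Space d))
    refine le_of_forall_lt_imp_le_of_dense fun t hts => ?_
    rcases lt_or_ge t 0 with ht | ht
    · exact ht.le.trans (dimFM_mem_Icc μ).2.1
    obtain ⟨ν, hac, hdec⟩ := h t ht hts
    exact (le_csSup (dimF_mem_Icc (ν : Measure (Space d))).1
      ⟨⟨ht, hts.le.trans hsd⟩, hdec⟩).trans (le_csSup (dimFM_mem_Icc μ).1 ⟨ν, hac, rfl⟩)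

theorem annihilators_nullSets_classM {s : ℝ} (hs : 0 ≤ s) (hsd : s ≤ d) :
    annihilators (nullSets (classM d s)) = classM d s := by
  refine Subset.antisymm (fun μ hμ => ?_) fun μ hμ E hE => hE.2 μ hμ
  refine (mem_classM_iff hs hsd μ).2 fun t ht hts => ?_
  rw [← annihilators_nullSets_classC d ht]
  exact fun E hE => hμ E ⟨hE.1, fun ν hν => hE.2 ν ((mem_classM_iff hs hsd ν).1 hν t ht hts)⟩

end FourierDim

theorem theorem5p1 (d : ℕ) :
    (∀ s : ℝ, 0 ≤ s →
      FourierDim.annihilators (FourierDim.nullSets (FourierDim.classC d s)) =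
        FourierDim.classC d s) ∧
    (∀ s : ℝ, 0 ≤ s → s ≤ (d : ℝ) →
      FourierDim.annihilators (FourierDim.nullSets (FourierDim.classM d s)) =
        FourierDim.classM d s) ∧
    (∀ s : ℝ, 0 ≤ s → s ≤ (d : ℝ) →
      ∀ μ : MeasureTheory.ProbabilityMeasure (FourierDim.Space d),
        s ≤ FourierDim.dimFM (μ : MeasureTheory.Measure (FourierDim.Space d)) ↔
          ∀ E : Set (FourierDim.Space d), MeasurableSet E →
            (∀ ν : MeasureTheory.ProbabilityMeasure (FourierDim.Space d),
              s ≤ FourierDim.dimFM (ν : MeasureTheory.Measure (FourierDim.Space d)) →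
                (ν : MeasureTheory.Measure (FourierDim.Space d)) E = 0) →
            (μ : MeasureTheory.Measure (FourierDim.Space d)) E = 0) := by
  refine ⟨fun s hs => FourierDim.annihilators_nullSets_classC d hs,
    fun s hs hsd => FourierDim.annihilators_nullSets_classM hs hsd, fun s hs hsd μ => ?_⟩
  have h : μ ∈ FourierDim.annihilators (FourierDim.nullSets (FourierDim.classM d s)) ↔
      μ ∈ FourierDim.classM d s := by
    rw [FourierDim.annihilators_nullSets_classM hs hsd]
  exact ⟨fun hμ E hE hν => h.2 hμ E ⟨hE, hν⟩, fun hμ => h.1 fun E hE => hμ E hE.1 hE.2⟩
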